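/- Let $\mathbb{K}$ be an algebraically closed field, let $n$ be a natural number, and let $G$ be a soluble subgroup of $GL_n(\mathbb{K})$. Then there exist a subgroup $H$ of $G$ of finite index $|G:H|$ and a non-singular $n \times n$ matrix $t$ over $\mathbb{K}$ such that every matrix $x \in t^{-1}Ht$ is upper triangular (that is, $x_{ij} = 0$ whenever $i > j$). -/

import Mathlib

open Module
open scoped commutatorElement

/-! Choose a minimal nonzero subspace `W` stable under some finite index subgroup; that subgroup
acts on `W` strongly irreducibly. It then acts by scalars (`scalar_of_isSolvable`), so any nonzero
vector of `W` is a common eigenvector, and induction on the quotient by its line gives triangular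
form. Scalarity climbs the derived series. A nonzero subspace with finite orbit is everything, so
commuting normal subgroups, and elements whose conjugates have finitely many images, act by scalars.
If commutators of a normal subgroup `B` act by scalars, conjugation characters and determinants
leave each element of `B` only finitely many conjugate images. -/

namespace Representation

variable {K G V ι : Type*} [Field K] [Group G] [AddCommGroup V] [Module K V]

/-! ### Finite index and joint eigenspaces -/

/-- If a function on a group takes finitely many values and its fibres lie in left cosets of `S`,
then `S` has finite index. -/
theorem finiteIndex_of_finite_range {X : Type*} (f : G → X) (S : Subgroup G)
    (hf : ∀ g h, f g = f h → g⁻¹ * h ∈ S) (hfin : (Set.range f).Finite) : S.FiniteIndex := by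
  have := hfin.to_subtype
  have : Finite (G ⧸ S) := by
    refine Finite.of_injective (fun q : G ⧸ S ↦ (⟨f q.out, _, rfl⟩ : Set.range f)) ?_
    intro p q hpq
    rw [← QuotientGroup.out_eq' p, ← QuotientGroup.out_eq' q]
    exact QuotientGroup.eq.2 (hf _ _ (congrArg Subtype.val hpq))
  exact Subgroup.finiteIndex_of_finite_quotient

/-- A commuting family of endomorphisms has only finitely many systems of joint eigenvalues. -/
theorem finite_iInf_eigenspace_ne_bot [FiniteDimensional K V] (f : ι → End K V)
    (hf : ∀ i j, Commute (f i) (f j)) :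
    {χ : ι → K | ⨅ i, (f i).eigenspace (χ i) ≠ ⊥}.Finite := by
  -- Joint generalized eigenspaces are independent, so finite dimension allows only finitely many
  -- nonzero ones.
  have h := Module.End.independent_iInf_maxGenEigenspace_of_forall_mapsTo f fun i j φ ↦
    Module.End.mapsTo_maxGenEigenspace_of_comm (hf j i) φ
  refine (WellFoundedGT.finite_ne_bot_of_iSupIndep h).subset fun χ hχ h0 ↦ hχ ?_
  refine eq_bot_iff.2 (le_trans (iInf_mono fun i ↦ ?_) h0.le)
  exact ((f i).genEigenspace (χ i)).monotone le_top

/-- A commuting family of endomorphisms over an algebraically closed field has a common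
eigenvector. -/
theorem exists_iInf_eigenspace_ne_bot [IsAlgClosed K] [FiniteDimensional K V] [Nontrivial V]
    (f : ι → End K V) (hf : ∀ i j, Commute (f i) (f j)) :
    ∃ χ : ι → K, ⨅ i, (f i).eigenspace (χ i) ≠ ⊥ := by
  obtain ⟨W, ⟨hW0, hW⟩, hmin⟩ := (wellFounded_lt (α := Submodule K V)).has_min
    {W | W ≠ ⊥ ∧ ∀ i, ∀ w ∈ W, f i w ∈ W} ⟨⊤, top_ne_bot, fun _ _ _ ↦ Submodule.mem_top⟩
  have key (i : ι) : ∃ c : K, W ≤ (f i).eigenspace c := by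
    have : Nontrivial W := Submodule.nontrivial_iff_ne_bot.2 hW0
    obtain ⟨c, hc⟩ := Module.End.exists_eigenvalue ((f i).restrict (hW i))
    obtain ⟨w, hw⟩ := hc.exists_hasEigenvector
    refine ⟨c, ?_⟩
    by_contra hle
    -- Commutation keeps this smaller intersection stable, against minimality of `W`.
    refine hmin (W ⊓ (f i).eigenspace c) ⟨?_, fun j v hv ↦ ⟨hW j v hv.1, ?_⟩⟩
      (inf_lt_left.2 hle)
    · refine (Submodule.ne_bot_iff _).2 ⟨w, ⟨w.2, ?_⟩, by simpa using hw.2⟩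
      simpa [Module.End.mem_eigenspace_iff] using congrArg Subtype.val hw.apply_eq_smul
    · have h1 := Module.End.mem_eigenspace_iff.1 hv.2
      have h2 : f i (f j v) = f j (f i v) := LinearMap.congr_fun (hf i j).eq v
      simp [h2, h1]
  choose χ hχ using key
  exact ⟨χ, fun h ↦ hW0 (eq_bot_iff.2 (h ▸ le_iInf hχ))⟩

/-! ### Strongly irreducible representations -/

variable (ρ : Representation K G V)

/-- A representation is strongly irreducible if no finite index subgroup stabilises a proper nonzero
subspace. -/
def IsStronglyIrreducible : Prop :=
  ∀ H : Subgroup G, H.FiniteIndex → ∀ W : Submodule K V,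
    (∀ h ∈ H, ∀ w ∈ W, ρ h w ∈ W) → W ≠ ⊥ → W = ⊤

variable {ρ}

theorem map_mul_eq_map (g h : G) (W : Submodule K V) :
    W.map (ρ (g * h)) = (W.map (ρ h)).map (ρ g) := by
  rw [map_mul, Module.End.mul_eq_comp, Submodule.map_comp]

theorem map_one_eq (W : Submodule K V) : W.map (ρ 1) = W := by
  rw [map_one, Module.End.one_eq_id, Submodule.map_id]

/-- A finite orbit makes the stabiliser of `W` a finite index subgroup. -/
theorem IsStronglyIrreducible.eq_top_of_finite (hρ : ρ.IsStronglyIrreducible) {W : Submodule K V}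
    (hW : W ≠ ⊥) (hfin : (Set.range fun g ↦ W.map (ρ g)).Finite) : W = ⊤ := by
  let S : Subgroup G :=
    { carrier := {g | W.map (ρ g) = W}
      one_mem' := map_one_eq W
      mul_mem' := fun {a b} ha hb ↦ by
        simp only [Set.mem_ofPred_eq] at ha hb ⊢
        rw [map_mul_eq_map, hb, ha]
      inv_mem' := fun {a} ha ↦ by
        simp only [Set.mem_ofPred_eq] at ha ⊢
        nth_rw 1 [← ha]
        rw [← map_mul_eq_map, inv_mul_cancel, map_one_eq] }
  have hS : S.FiniteIndex := by
    refine finiteIndex_of_finite_range _ S (fun g h hgh ↦ ?_) hfin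
    change W.map (ρ (g⁻¹ * h)) = W
    beta_reduce at hgh
    rw [map_mul_eq_map, ← hgh, ← map_mul_eq_map, inv_mul_cancel, map_one_eq]
  refine hρ S hS W (fun h hh w hw ↦ ?_) hW
  rw [← show W.map (ρ h) = W from hh]
  exact Submodule.mem_map_of_mem hw

theorem apply_inv_apply (g : G) (v : V) : ρ g (ρ g⁻¹ v) = v := by
  rw [← Module.End.mul_apply, ← map_mul, mul_inv_cancel, map_one, Module.End.one_apply]

theorem map_eigenspace (k g : G) (c : K) :
    (Module.End.eigenspace (ρ g) c).map (ρ k) = Module.End.eigenspace (ρ (k * g * k⁻¹)) c := by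
  ext v
  simp only [Submodule.mem_map, Module.End.mem_eigenspace_iff]
  constructor
  · rintro ⟨w, hw, rfl⟩
    rw [← Module.End.mul_apply, ← map_mul, inv_mul_cancel_right, map_mul, Module.End.mul_apply, hw,
      map_smul]
  · intro hv
    refine ⟨ρ k⁻¹ v, ?_, apply_inv_apply k v⟩
    rw [← map_smul, ← hv]
    simp only [← Module.End.mul_apply, ← map_mul]
    congr 2
    group

/-- Translates of an eigenspace of `ρ g` are eigenspaces of conjugates of `g`, so its orbit is
finite. -/
theorem IsStronglyIrreducible.scalar_of_finite_conj [IsAlgClosed K] [FiniteDimensional K V]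
    [Nontrivial V] (hρ : ρ.IsStronglyIrreducible) (g : G)
    (hfin : (Set.range fun k ↦ ρ (k * g * k⁻¹)).Finite) : ∃ c : K, ρ g = c • 1 := by
  obtain ⟨c, hc⟩ := Module.End.exists_eigenvalue (ρ g)
  have h := hρ.eq_top_of_finite hc (by
    simp only [map_eigenspace]
    exact (hfin.image fun x ↦ Module.End.eigenspace x c).subset (by rintro _ ⟨k, rfl⟩; exact ⟨_, ⟨k, rfl⟩, rfl⟩))
  refine ⟨c, LinearMap.ext fun v ↦ ?_⟩
  exact Module.End.mem_eigenspace_iff.1 (show v ∈ Module.End.eigenspace (ρ g) c from h.ge Submodule.mem_top)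

theorem map_iInf_eigenspace (A : Subgroup G) [A.Normal] (k : G) (χ : A → K) :
    (⨅ a : A, Module.End.eigenspace (ρ a) (χ a)).map (ρ k) =
      ⨅ a : A, Module.End.eigenspace (ρ a) (χ (MulAut.conjNormal k⁻¹ a)) := by
  have hinj : Function.Injective (ρ k) := by
    refine Function.LeftInverse.injective (g := ρ k⁻¹) fun v ↦ ?_
    simp
  rw [Submodule.map_iInf _ hinj, ← (MulAut.conjNormal k⁻¹ : A ≃* A).toEquiv.iInf_comp]
  refine iInf_congr fun a ↦ ?_
  rw [map_eigenspace]
  simp [mul_assoc]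

/-- By normality `G` permutes the nonzero joint eigenspaces of `A`, which are finitely many. -/
theorem IsStronglyIrreducible.scalar_of_commute [IsAlgClosed K] [FiniteDimensional K V]
    [Nontrivial V] (hρ : ρ.IsStronglyIrreducible) (A : Subgroup G) [A.Normal]
    (hA : ∀ a ∈ A, ∀ b ∈ A, Commute (ρ a) (ρ b)) {a : G} (ha : a ∈ A) : ∃ c : K, ρ a = c • 1 := by
  have hcomm : ∀ a b : A, Commute (ρ a) (ρ b) := fun a b ↦ hA a a.2 b b.2
  obtain ⟨χ, hχ⟩ := exists_iInf_eigenspace_ne_bot (fun a : A ↦ ρ a) hcomm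
  have h := hρ.eq_top_of_finite hχ (by
    refine ((finite_iInf_eigenspace_ne_bot (fun a : A ↦ ρ a) hcomm).image
      fun χ ↦ ⨅ a : A, Module.End.eigenspace (ρ a) (χ a)).subset ?_
    rintro _ ⟨k, rfl⟩
    refine ⟨fun a ↦ χ (MulAut.conjNormal k⁻¹ a), ?_, (map_iInf_eigenspace A k χ).symm⟩
    rw [Set.mem_ofPred_eq, ← map_iInf_eigenspace]
    intro h0
    apply hχ
    rw [← map_one_eq (ρ := ρ) (⨅ a : A, Module.End.eigenspace (ρ a) (χ a)), ← inv_mul_cancel k, map_mul_eq_map,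
      h0, Submodule.map_bot])
  refine ⟨χ ⟨a, ha⟩, LinearMap.ext fun v ↦ ?_⟩
  have hv : v ∈ ⨅ a : A, Module.End.eigenspace (ρ a) (χ a) := h ▸ Submodule.mem_top
  exact Module.End.mem_eigenspace_iff.1 ((Submodule.mem_iInf _).1 hv ⟨a, ha⟩)

/-- The conjugation action of a group on the endomorphisms of a representation. -/
def conjEnd (ρ : Representation K G V) : Representation K G (End K V) where
  toFun g := LinearMap.mulLeft K (ρ g) ∘ₗ LinearMap.mulRight K (ρ g⁻¹)
  map_one' := by ext; simp
  map_mul' g h := by ext; simp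

theorem conjEnd_apply (g : G) (x : End K V) : ρ.conjEnd g x = ρ g * (x * ρ g⁻¹) := rfl

theorem conjEnd_of_scalar {g : G} {c : K} (h : ρ g = c • 1) : ρ.conjEnd g = 1 := by
  ext1 x
  have : ρ g * x = x * ρ g := by simp [h]
  rw [conjEnd_apply, ← mul_assoc, this, mul_assoc, ← map_mul, mul_inv_cancel, map_one, mul_one,
    Module.End.one_apply]

theorem IsStronglyIrreducible.scalar_of_commutator_scalar [IsAlgClosed K] [FiniteDimensional K V]
    [Nontrivial V] (hρ : ρ.IsStronglyIrreducible) (B : Subgroup G) [B.Normal]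
    (hB : ∀ a ∈ B, ∀ b ∈ B, ∃ c : K, ρ ⁅a, b⁆ = c • 1) {b : G} (hb : b ∈ B) :
    ∃ c : K, ρ b = c • 1 := by
  -- The elements of `B` that act centrally in `ρ(B)`; being commuting and normal, they act by
  -- scalars.
  let A : Subgroup G :=
    { carrier := {a | a ∈ B ∧ ∀ c ∈ B, Commute (ρ a) (ρ c)}
      one_mem' := ⟨B.one_mem, fun c _ ↦ by simp⟩
      mul_mem' := fun {x y} hx hy ↦ ⟨B.mul_mem hx.1 hy.1, fun c hc ↦ by
        rw [map_mul]; exact (hx.2 c hc).mul_left (hy.2 c hc)⟩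
      inv_mem' := fun {x} hx ↦ ⟨B.inv_mem hx.1, fun c hc ↦ by
        have h := (hx.2 c hc).eq
        have h1 : ρ x⁻¹ * (ρ x * ρ c) * ρ x⁻¹ = ρ x⁻¹ * (ρ c * ρ x) * ρ x⁻¹ := by rw [h]
        simp only [← map_mul] at h1
        rw [Commute, SemiconjBy, ← map_mul, ← map_mul]
        simpa [mul_assoc] using h1.symm⟩ }
  have hAn : A.Normal := ⟨fun x hx g ↦ ⟨‹B.Normal›.conj_mem x hx.1 g, fun c hc ↦ by
    have h := (hx.2 (g⁻¹ * c * g) (by simpa using ‹B.Normal›.conj_mem c hc g⁻¹)).eq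
    have h1 : ρ g * (ρ x * ρ (g⁻¹ * c * g)) * ρ g⁻¹ = ρ g * (ρ (g⁻¹ * c * g) * ρ x) * ρ g⁻¹ := by
      rw [h]
    simp only [← map_mul] at h1
    rw [Commute, SemiconjBy, ← map_mul, ← map_mul]
    simpa [mul_assoc] using h1⟩⟩
  have hA {a : G} (ha : a ∈ A) : ∃ c : K, ρ a = c • 1 :=
    hρ.scalar_of_commute A (fun a ha b hb ↦ ha.2 b hb.1) ha
  refine hρ.scalar_of_finite_conj b ?_
  -- `c * d` and `d * c` act alike up to a scalar, which conjugation does not see.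
  have hcomm : ∀ c d : B, Commute (ρ.conjEnd c) (ρ.conjEnd d) := fun c d ↦ by
    obtain ⟨z, hz⟩ := hB c c.2 d d.2
    rw [Commute, SemiconjBy, ← map_mul, ← map_mul,
      show (c * d : G) = ⁅(c : G), (d : G)⁆ * (d * c) by simp [commutatorElement_def, mul_assoc],
      map_mul, conjEnd_of_scalar hz, one_mul]
  have hfin := finite_iInf_eigenspace_ne_bot (fun c : B ↦ ρ.conjEnd c) hcomm
  have hne (x : G) : ρ x ≠ 0 := fun h ↦ by
    have : ρ x * ρ x⁻¹ = 1 := by rw [← map_mul, mul_inv_cancel, map_one]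
    rw [h, zero_mul] at this
    exact zero_ne_one this
  -- Sort the conjugates of `b` by their character under conjugation by `B`. Equal characters give a
  -- quotient in `A`, hence a scalar; equal determinants make it a root of unity.
  refine (hfin.biUnion (t := fun χ ↦ {y | ∃ x ∈ B, ρ x = y ∧ LinearMap.det y = LinearMap.det (ρ b) ∧
    y ∈ ⨅ c : B, Module.End.eigenspace (ρ.conjEnd c) (χ c)}) fun χ _ ↦ ?_).subset ?_
  · rcases Set.eq_empty_or_nonempty {y | ∃ x ∈ B, ρ x = y ∧
      LinearMap.det y = LinearMap.det (ρ b) ∧ y ∈ ⨅ c : B, Module.End.eigenspace (ρ.conjEnd c) (χ c)} with h | h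
    · rw [h]; exact Set.finite_empty
    obtain ⟨_, x₀, hx₀, rfl, hd₀, he₀⟩ := h
    have hroots : {z : K | z ^ finrank K V = 1}.Finite := by
      classical
      refine (Polynomial.nthRoots (finrank K V) (1 : K)).toFinset.finite_toSet.subset fun z hz ↦ ?_
      simpa [Polynomial.mem_nthRoots (finrank_pos (R := K) (M := V))] using hz
    refine (hroots.image fun z ↦ z • ρ x₀).subset ?_
    rintro _ ⟨x, hx, rfl, hd, he⟩
    have hxA : x * x₀⁻¹ ∈ A := by
      refine ⟨B.mul_mem hx (B.inv_mem hx₀), fun c hc ↦ ?_⟩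
      have h1 := Module.End.mem_eigenspace_iff.1 ((Submodule.mem_iInf _).1 he ⟨c, hc⟩)
      have h0 := Module.End.mem_eigenspace_iff.1 ((Submodule.mem_iInf _).1 he₀ ⟨c, hc⟩)
      rw [conjEnd_apply, ← map_mul, ← map_mul] at h1 h0
      have e1 : ρ c * ρ x = χ ⟨c, hc⟩ • (ρ x * ρ c) := by
        rw [← smul_mul_assoc, ← h1, ← map_mul, ← map_mul]
        simp [mul_assoc]
      have e0 : ρ x₀⁻¹ * ρ c = χ ⟨c, hc⟩ • (ρ c * ρ x₀⁻¹) := by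
        have h : ρ x₀⁻¹ * (χ ⟨c, hc⟩ • ρ x₀) * (ρ c * ρ x₀⁻¹) = ρ x₀⁻¹ * ρ c := by
          rw [← h0]
          simp only [← map_mul]
          congr 1
          group
        rw [← h, mul_smul_comm, ← map_mul, inv_mul_cancel, map_one, smul_mul_assoc, one_mul]
      rw [Commute, SemiconjBy, map_mul, mul_assoc, e0, ← mul_assoc, e1, mul_smul_comm,
        smul_mul_assoc, mul_assoc]
    obtain ⟨z, hz⟩ := hA hxA
    have hxz : ρ x = z • ρ x₀ := by
      rw [← inv_mul_cancel_right x x₀, map_mul, hz, smul_mul_assoc, one_mul]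
    refine ⟨z, ?_, hxz.symm⟩
    rw [hxz, LinearMap.det_smul, hd₀] at hd
    refine mul_right_cancel₀ (b := LinearMap.det (ρ b)) (fun h0 ↦ ?_) (hd.trans (one_mul _).symm)
    have := congrArg LinearMap.det (show ρ b * ρ b⁻¹ = 1 by rw [← map_mul, mul_inv_cancel, map_one])
    rw [map_mul, h0, zero_mul, map_one] at this
    exact zero_ne_one this
  · rintro _ ⟨k, rfl⟩
    set x := k * b * k⁻¹
    have hxB : x ∈ B := ‹B.Normal›.conj_mem b hb k
    choose χ hχ using fun c : B ↦ hB c c.2 x hxB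
    have hmem : ρ x ∈ ⨅ c : B, Module.End.eigenspace (ρ.conjEnd c) (χ c) := by
      refine (Submodule.mem_iInf _).2 fun c ↦ Module.End.mem_eigenspace_iff.2 ?_
      rw [conjEnd_apply, ← map_mul, ← map_mul,
        show (c : G) * (x * (c : G)⁻¹) = ⁅(c : G), x⁆ * x by simp [commutatorElement_def, mul_assoc],
        map_mul, hχ, smul_mul_assoc, one_mul]
    refine Set.mem_biUnion (x := χ) ((Submodule.ne_bot_iff _).2 ⟨_, hmem, hne x⟩)
      ⟨x, hxB, rfl, ?_, hmem⟩
    have h1 : LinearMap.det (ρ k) * LinearMap.det (ρ k⁻¹) = 1 := by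
      rw [← map_mul, ← map_mul, mul_inv_cancel, map_one, map_one]
    beta_reduce
    rw [map_mul, map_mul, map_mul, map_mul, mul_right_comm, h1, one_mul]

theorem IsStronglyIrreducible.scalar_of_isSolvable [IsAlgClosed K] [FiniteDimensional K V]
    [Nontrivial V] (hρ : ρ.IsStronglyIrreducible) [hG : Group.IsSolvable G] (g : G) :
    ∃ c : K, ρ g = c • 1 := by
  obtain ⟨n, hn⟩ := hG.solvable
  have hbase : ∀ g ∈ derivedSeries G n, ∃ c : K, ρ g = c • 1 := fun g hg ↦ by
    rw [hn, Subgroup.mem_bot] at hg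
    exact ⟨1, by rw [hg, map_one, one_smul]⟩
  clear hn
  induction n with
  | zero => exact hbase g (Subgroup.mem_top g)
  | succ n ih =>
    exact ih fun g hg ↦ hρ.scalar_of_commutator_scalar (derivedSeries G n)
      (fun a ha b hb ↦ hbase _ (Subgroup.commutator_mem_commutator ha hb)) hg

/-! ### Triangularization on a finite index subgroup -/

/-- A solvable group has a finite index subgroup with a common eigenvector. -/
theorem exists_finiteIndex_eigenvector [IsAlgClosed K] [FiniteDimensional K V] [Nontrivial V]
    [Group.IsSolvable G] (ρ : Representation K G V) :
    ∃ H : Subgroup G, H.FiniteIndex ∧ ∃ v : V, v ≠ 0 ∧ ∀ h ∈ H, ∃ c : K, ρ h v = c • v := by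
  obtain ⟨W, ⟨hW0, H, hH, hW⟩, hmin⟩ := (wellFounded_lt (α := Submodule K V)).has_min
    {W | W ≠ ⊥ ∧ ∃ H : Subgroup G, H.FiniteIndex ∧ ∀ h ∈ H, ∀ w ∈ W, ρ h w ∈ W}
    ⟨⊤, top_ne_bot, ⊤, inferInstance, fun _ _ _ _ ↦ Submodule.mem_top⟩
  have : Nontrivial W := Submodule.nontrivial_iff_ne_bot.2 hW0
  let σ : Representation K H W :=
    Representation.subrepresentation (ρ.comp H.subtype) W fun h w hw ↦ hW h h.2 w hw
  have hσ : σ.IsStronglyIrreducible := by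
    intro L hL U hU hU0
    by_contra hne
    refine hmin (U.map W.subtype) ⟨?_, L.map H.subtype, ⟨?_⟩, ?_⟩ ?_
    · rwa [Ne, (Submodule.map_injective_of_injective W.injective_subtype).eq_iff' (Submodule.map_bot _)]
    · rw [Subgroup.index_map_subtype]
      exact mul_ne_zero hL.index_ne_zero hH.index_ne_zero
    · rintro _ ⟨l, hl, rfl⟩ _ ⟨u, hu, rfl⟩
      exact ⟨σ l u, hU l hl u hu, rfl⟩
    · refine lt_of_le_of_ne (Submodule.map_subtype_le W U) fun h ↦ hne ?_
      exact Submodule.map_injective_of_injective W.injective_subtype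
        (h.trans (Submodule.map_subtype_top W).symm)
  obtain ⟨w, hw⟩ := exists_ne (0 : W)
  refine ⟨H, hH, w, by simpa using hw, fun h hh ↦ ?_⟩
  obtain ⟨c, hc⟩ := hσ.scalar_of_isSolvable ⟨h, hh⟩
  exact ⟨c, congrArg Subtype.val (LinearMap.congr_fun hc w)⟩

/-- **Mal'cev's theorem**: a finite-dimensional representation of a solvable group over an
algebraically closed field is triangularizable on a finite index subgroup. -/
theorem exists_finiteIndex_triangular [IsAlgClosed K] (n : ℕ) {G V : Type*} [Group G]
    [Group.IsSolvable G] [AddCommGroup V] [Module K V] [FiniteDimensional K V]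
    (ρ : Representation K G V) (hn : finrank K V = n) :
    ∃ H : Subgroup G, H.FiniteIndex ∧ ∃ b : Basis (Fin n) K V,
      ∀ h ∈ H, ∀ i j : Fin n, j < i → b.repr (ρ h (b j)) i = 0 := by
  induction n generalizing G V with
  | zero => exact ⟨⊤, inferInstance, finBasisOfFinrankEq K V hn, fun _ _ i ↦ i.elim0⟩
  | succ n ih =>
    have : Nontrivial V := nontrivial_of_finrank_pos (R := K) (by omega)
    obtain ⟨H, hH, v, hv, hvH⟩ := ρ.exists_finiteIndex_eigenvector
    let W := K ∙ v
    have hW (h : G) (hh : h ∈ H) (w : V) (hw : w ∈ W) : ρ h w ∈ W := by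
      obtain ⟨a, rfl⟩ := Submodule.mem_span_singleton.1 hw
      obtain ⟨c, hc⟩ := hvH h hh
      rw [map_smul, hc]
      exact W.smul_mem _ (W.smul_mem _ (Submodule.mem_span_singleton_self v))
    have hW1 : finrank K W = 1 := finrank_span_singleton hv
    let σ : Representation K H (V ⧸ W) :=
      Representation.quotient (ρ.comp H.subtype) W fun h w hw ↦ hW h h.2 w hw
    obtain ⟨L, hL, b, hb⟩ := ih σ (by have := W.finrank_quotient_add_finrank; omega)
    -- The eigenvector line takes index 0 and the quotient basis is shifted by one, as upper
    -- triangularity requires.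
    obtain ⟨e, hel, her⟩ : ∃ e : Fin 1 ⊕ Fin n ≃ Fin (n + 1),
        (∀ i, (e (Sum.inl i) : ℕ) = 0) ∧ ∀ i, (e (Sum.inr i) : ℕ) = 1 + i :=
      ⟨finSumFinEquiv.trans (finCongr (Nat.add_comm 1 n)), by simp, by simp [add_comm]⟩
    let bW := finBasisOfFinrankEq K W hW1
    refine ⟨L.map H.subtype, ⟨?_⟩, (bW.sumQuot b).reindex e, ?_⟩
    · rw [Subgroup.index_map_subtype]
      exact mul_ne_zero hL.index_ne_zero hH.index_ne_zero
    rintro _ ⟨l, hl, rfl⟩ i j hij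
    replace hij : e (e.symm j) < e (e.symm i) := by simpa using hij
    rw [Basis.reindex_apply, Basis.repr_reindex_apply]
    generalize e.symm i = i at hij ⊢
    generalize e.symm j = j at hij ⊢
    rcases i with i | i
    · exfalso
      rw [Fin.lt_def] at hij
      have := hel i
      omega
    rcases j with j | j
    · refine Basis.sumQuot_repr_inr_of_mem _ _ _ (hW l l.2 _ ?_) i
      rw [Basis.sumQuot_inl]
      exact Subtype.mem _
    · rw [Basis.sumQuot_repr_inr]
      have h : W.mkQ (ρ l (bW.sumQuot b (Sum.inr j))) = σ l (b j) := by
        rw [← Basis.sumQuot_inr bW b j]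
        rfl
      refine (congrArg (fun x ↦ b.repr x i) h).trans (hb l hl i j ?_)
      rw [Fin.lt_def, her, her] at hij
      exact Fin.lt_def.2 (by omega)

end Representation

/-! ### Matrix form -/

theorem theorem9p4 {K : Type*} [Field K] [IsAlgClosed K] (n : ℕ)
    (G : Subgroup (Matrix.GeneralLinearGroup (Fin n) K)) (hG : Group.IsSolvable G) :
    ∃ H : Subgroup (Matrix.GeneralLinearGroup (Fin n) K),
      H ≤ G ∧ H.relIndex G ≠ 0 ∧
      ∃ t : Matrix.GeneralLinearGroup (Fin n) K,
        ∀ h ∈ H, ∀ i j : Fin n, j < i →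
          ((t⁻¹ * h * t : Matrix.GeneralLinearGroup (Fin n) K) : Matrix (Fin n) (Fin n) K) i j = 0 := by
  let ρ : Representation K G (Fin n → K) :=
    ((Matrix.toLinAlgEquiv' (R := K) (n := Fin n)).toAlgHom : _ →* _).comp
      ((Units.coeHom _).comp G.subtype)
  obtain ⟨H, hH, b, hb⟩ := ρ.exists_finiteIndex_triangular n (by simp)
  let p := Pi.basisFun K (Fin n)
  refine ⟨H.map G.subtype, Subgroup.map_subtype_le H, ?_,
    ⟨p.toMatrix b, b.toMatrix p, by simp, by simp⟩, ?_⟩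
  · rw [Subgroup.relIndex, Subgroup.subgroupOf, Subgroup.comap_map_eq_self_of_injective
      G.subtype_injective]
    exact hH.index_ne_zero
  rintro _ ⟨h, hh, rfl⟩ i j hij
  -- With `t` the matrix whose columns are the vectors of `b`, conjugation by `t` is the change to
  -- the basis `b`.
  have key : b.toMatrix p * ((h : Matrix.GeneralLinearGroup (Fin n) K) : Matrix (Fin n) (Fin n) K) *
      p.toMatrix b = LinearMap.toMatrix b b (ρ h) := by
    rw [← basis_toMatrix_mul_linearMap_toMatrix_mul_basis_toMatrix b p b p (ρ h)]
    congr 2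
    exact (LinearMap.toMatrix'_toLin' _).symm
  have := hb h hh i j hij
  rw [← LinearMap.toMatrix_apply, ← key] at this
  exact this
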